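/- Let $R$ be a Noetherian integral domain with field of fractions $K$ and let $M$ be a finitely generated torsion-free $R$-module. Put $M_K=M\otimes_R K$, so that $M\subseteq M_K$, and for a ring $V$ with $R\subseteq V\subseteq K$ let $MV$ be the $V$-submodule of $M_K$ generated by $M$. An element $v\in M_K$ is integral over $M$ if $v\in MV$ for every discrete valuation ring $V$ with $R\subseteq V\subseteq K$ whose field of fractions is $K$. The module $M$ is integrally closed if it equals its integral closure, i.e. the set of all elements of $M_K$ that are integral over $M$. Let $(R,\mathfrak m)$ be a $2$-dimensional regular local ring and let $\widehat R$ be its $\mathfrak m$-adic completion. If $M$ is a finitely generated, integrally closed, torsion-free $R$-module, then $M\otimes_R\widehat R$ is a finitely generated, integrally closed, torsion-free $\widehat R$-module. -/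

import Mathlib

open scoped TensorProduct

namespace ModuleClosure

universe u v

/-- `V` is a discrete valuation ring of `K`: a subring of `K` which is a discrete valuation ring
with field of fractions `K`. -/
structure IsDVROf {K : Type u} [CommRing K] (V : Subring K) : Prop where
  isDomain : IsDomain V
  isDiscreteValuationRing : IsDiscreteValuationRing V
  isFractionRing : IsFractionRing V K

variable (R : Type u) [CommRing R] (M : Type v) [AddCommGroup M] [Module R M]

/-- `M_K = K ⊗[R] M`, where `K` is the fraction field of the domain `R`. -/
abbrev Generic : Type (max u v) := FractionRing R ⊗[R] M

/-- The canonical map `M → M_K`, which is injective for `M` torsion-free. -/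
noncomputable def toGeneric : M →ₗ[R] Generic R M :=
  TensorProduct.mk R (FractionRing R) M 1

/-- `MV`, the `V`-submodule of `M_K` generated by the image of `M`,
for a subring `V` of the fraction field `K`. -/
noncomputable def extend (V : Subring (FractionRing R)) : Submodule V (Generic R M) :=
  Submodule.span V (Set.range (toGeneric R M))

variable {R M} in
/-- `x ∈ M_K` is integral over `M` if `x ∈ MV` for every discrete valuation ring `V` of `K`
containing `R`. -/
def IsIntegralOver (x : Generic R M) : Prop :=
  ∀ V : Subring (FractionRing R), IsDVROf V → (algebraMap R (FractionRing R)).range ≤ V →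
    x ∈ extend R M V

/-- The integral closure of `M`: the set of all elements of `M_K` that are integral over `M`. -/
def integralClosure : Set (Generic R M) :=
  {x | IsIntegralOver x}

/-- `M` is integrally closed: `M`, identified with its image in `M_K`, is equal to its
integral closure. -/
def IsIntegrallyClosed : Prop :=
  Set.range (toGeneric R M) = integralClosure R M

end ModuleClosure

/-!
Write `A` for the completion of `R` and `K`, `L` for the fraction fields of `R` and `A`. In both
rings every nonmaximal prime is principal, so the localisation at it is a field or a discrete
valuation ring; hence an element `v` of `L ⊗ M` integral over `A ⊗ M` is carried into `A ⊗ M` by a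
power of the maximal ideal. As `R` is dense in `A`, such a `v` agrees modulo `A ⊗ M` with an element
`x` of `K ⊗ M`, and it remains to see that `x` is integral over `M`.

If it were not, some functional `l : M → K` with values in a discrete valuation ring `V ⊇ R` would
have `c = l x ∉ V`. Let `T` be the `R`-algebra generated by `c⁻¹` and the image of `l`. By faithful
flatness `c ∉ A[T]`, so `c⁻¹` is a nonunit of the Noetherian domain `A[T]`, and a discrete valuation
ring of `L` containing `A[T]` but not `c` contradicts the integrality of `x` over `A ⊗ M`. This
valuation ring comes from the Krull–Akizuki theorem.
-/

namespace ModuleClosure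

section KrullAkizuki

variable {B : Type*} [CommRing B]

lemma length_quotient_range_comp {L M N : Type*} [AddCommGroup L] [AddCommGroup M]
    [AddCommGroup N] [Module B L] [Module B M] [Module B N] (f : L →ₗ[B] M) (g : M →ₗ[B] N)
    (hg : Function.Injective g) :
    Module.length B (N ⧸ LinearMap.range (g ∘ₗ f)) =
      Module.length B (M ⧸ LinearMap.range f) + Module.length B (N ⧸ LinearMap.range g) := by
  have hle : LinearMap.range (g ∘ₗ f) ≤ LinearMap.range g := LinearMap.range_comp_le_range f g
  have hcomap : LinearMap.range f = (LinearMap.range (g ∘ₗ f)).comap g := by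
    rw [LinearMap.range_comp, Submodule.comap_map_eq_of_injective hg]
  refine Module.length_eq_add_of_exact (Submodule.mapQ _ _ g hcomap.le) (Submodule.factor hle)
    ?_ (Submodule.factor_surjective hle) ?_
  · rw [← LinearMap.ker_eq_bot, Submodule.ker_mapQ, ← hcomap, Submodule.mkQ_map_self]
  · rw [LinearMap.exact_iff, Submodule.factor, Submodule.ker_mapQ, Submodule.range_mapQ,
      Submodule.comap_id]

lemma isNoetherian_of_forall_fg_length_le {X : Type*} [AddCommGroup X] [Module B X] {l : ℕ∞}
    (hl : l ≠ ⊤) (h : ∀ N : Submodule B X, N.FG → Module.length B N ≤ l) : IsNoetherian B X := by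
  lift l to ℕ using hl
  have hheight (N : {N : Submodule B X // N.FG}) : Order.height N.1 ≤ l :=
    Module.length_submodule (N := N.1) ▸ h N.1 N.2
  have hlt (N : {N : Submodule B X // N.FG}) : Order.height N.1 < ⊤ :=
    (hheight N).trans_lt (ENat.natCast_lt_top l)
  rw [isNoetherian_iff_fg_wellFounded]
  let height (N : {N : Submodule B X // N.FG}) : Fin (l + 1) :=
    ⟨(Order.height N.1).toNat, Nat.lt_succ_of_le (ENat.toNat_le_of_le_natCast (hheight N))⟩
  have hmono : StrictMono height := fun N N' hNN' => by
    rw [Fin.mk_lt_mk, ← ENat.natCast_lt_natCast, ENat.natCast_toNat (hlt N).ne,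
      ENat.natCast_toNat (hlt N').ne]
    exact Order.height_strictMono hNN' (hlt N)
  exact hmono.wellFoundedGT

variable [IsDomain B] {K : Type*} [Field K] [Algebra B K] [IsFractionRing B K]

variable (K) in
lemma exists_injective_of_injective_fractionField {N : Type*} [AddCommGroup N] [Module B N]
    [Module.Finite B N] {i : N →ₗ[B] K} (hi : Function.Injective i) :
    ∃ f : N →ₗ[B] B, Function.Injective f := by
  obtain ⟨d, hd, hdN⟩ := FractionalIdeal.isFractional_of_fg (S := nonZeroDivisors B)
    (Submodule.fg_range i)
  have hrange (n : N) : (d • i) n ∈ LinearMap.range (Algebra.linearMap B K) :=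
    hdN (i n) (LinearMap.mem_range_self i n)
  let e := LinearEquiv.ofInjective (Algebra.linearMap B K) (IsFractionRing.injective B K)
  refine ⟨e.symm.toLinearMap ∘ₗ (d • i).codRestrict _ hrange, ?_⟩
  refine e.symm.injective.comp fun m n hmn => hi ?_
  exact smul_right_injective K (nonZeroDivisors.ne_zero hd) (congrArg Subtype.val hmn)

variable [IsNoetherianRing B] [Ring.KrullDimLE 1 B]

lemma length_quotient_range_lsmul_le_ord {N : Type*} [AddCommGroup N] [Module B N]
    {f : N →ₗ[B] B} (hf : Function.Injective f) {b : B} (hb : b ≠ 0) :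
    Module.length B (N ⧸ LinearMap.range (LinearMap.lsmul B N b)) ≤ Ring.ord B b := by
  rcases subsingleton_or_nontrivial N with _ | _
  · simp
  obtain ⟨n, hn⟩ := exists_ne (0 : N)
  have hfin : Module.length B (B ⧸ LinearMap.range f) ≠ ⊤ := by
    have hfn : f n ≠ 0 := (map_ne_zero_iff f hf).mpr hn
    have hle : Ideal.span {f n} ≤ LinearMap.range f := by
      rw [Ideal.span_singleton_le_iff_mem]
      exact LinearMap.mem_range_self f n
    exact ne_top_of_le_ne_top (Ring.ord_ne_top (mem_nonZeroDivisors_of_ne_zero hfn))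
      (Module.length_le_of_surjective _ (Submodule.factor_surjective hle))
  have hrange : LinearMap.range (LinearMap.lsmul B B b) = Ideal.span {b} := by
    ext x
    simp [Ideal.mem_span_singleton', mul_comm]
  have hcomm : f ∘ₗ LinearMap.lsmul B N b = LinearMap.lsmul B B b ∘ₗ f := by
    ext x
    simp
  -- The length of `B ⧸ b f(N)` computed along `b f(N) ≤ f(N) ≤ B` and along `b f(N) ≤ b B ≤ B`.
  have hlength := length_quotient_range_comp (LinearMap.lsmul B N b) f hf
  rw [hcomm, length_quotient_range_comp f _ (mul_right_injective₀ hb), hrange, add_comm] at hlength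
  exact (WithTop.add_right_cancel hfin hlength).ge

variable (B K) {W : Type*} [CommRing W] [Algebra B W] [Algebra W K] [IsScalarTower B W K]
  [FaithfulSMul W K]

include K in
lemma length_le_ord_of_fg {b : B} (hb : b ≠ 0)
    (N : Submodule B (W ⧸ Ideal.span {algebraMap B W b})) (hN : N.FG) :
    Module.length B N ≤ Ring.ord B b := by
  obtain ⟨s, rfl⟩ := hN
  let π : W →ₗ[B] W ⧸ Ideal.span {algebraMap B W b} :=
    (Ideal.Quotient.mkₐ B (Ideal.span {algebraMap B W b})).toLinearMap
  obtain ⟨N, hN, hNs⟩ : ∃ N : Submodule B W, N.FG ∧ N.map π = Submodule.span B s := by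
    have hπ : Function.Surjective π := Ideal.Quotient.mk_surjective
    refine ⟨Submodule.span B (Function.surjInv hπ '' s),
      Submodule.fg_span (s.finite_toSet.image _), ?_⟩
    rw [Submodule.map_span, ← Set.image_comp,
      (Function.rightInverse_surjInv hπ).comp_eq_id, Set.image_id]
  have : Module.Finite B N := Module.Finite.iff_fg.mpr hN
  obtain ⟨f, hf⟩ := exists_injective_of_injective_fractionField K
    (i := (IsScalarTower.toAlgHom B W K).toLinearMap ∘ₗ N.subtype)
    ((FaithfulSMul.algebraMap_injective W K).comp N.injective_subtype)
  have hker : LinearMap.range (LinearMap.lsmul B N b) ≤ LinearMap.ker (π.submoduleMap N) := by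
    rintro _ ⟨x, rfl⟩
    refine Subtype.ext (Ideal.Quotient.eq_zero_iff_mem.mpr ?_)
    rw [LinearMap.lsmul_apply, map_smul, Algebra.smul_def]
    exact Ideal.mul_mem_right _ _ (Ideal.mem_span_singleton_self _)
  rw [← hNs]
  refine (Module.length_le_of_surjective (Submodule.liftQ _ (π.submoduleMap N) hker) ?_).trans
    (length_quotient_range_lsmul_le_ord hf hb)
  exact Function.Surjective.of_comp (g := Submodule.mkQ _) (π.submoduleMap_surjective N)

include B K in
/-- The **Krull–Akizuki theorem** for rings between `B` and its field of fractions `K`. -/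
theorem isNoetherianRing_of_krullDimLE_one : IsNoetherianRing W := by
  refine ⟨fun J => ?_⟩
  rcases eq_or_ne J ⊥ with rfl | hJ
  · exact Submodule.fg_bot
  obtain ⟨w, hwJ, hw⟩ := Submodule.exists_mem_ne_zero_of_ne_bot hJ
  obtain ⟨b, hb, hbJ⟩ : ∃ b : B, b ≠ 0 ∧ algebraMap B W b ∈ J := by
    have : IsDomain W := (FaithfulSMul.algebraMap_injective W K).isDomain
    have : Algebra.IsAlgebraic B K := IsLocalization.isAlgebraic K (nonZeroDivisors B)
    have : Algebra.IsAlgebraic B W :=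
      .tower_bot_of_injective (A := K) (FaithfulSMul.algebraMap_injective W K)
    have hwalg : IsAlgebraic B w := Algebra.IsAlgebraic.isAlgebraic w
    obtain ⟨b, hb, hwb⟩ := hwalg.exists_nonzero_dvd (mem_nonZeroDivisors_of_ne_zero hw)
    exact ⟨b, hb, Ideal.mem_of_dvd J hwb hwJ⟩
  have : IsNoetherian B (W ⧸ Ideal.span {algebraMap B W b}) :=
    isNoetherian_of_forall_fg_length_le (Ring.ord_ne_top (mem_nonZeroDivisors_of_ne_zero hb))
      (length_le_ord_of_fg B K hb)
  have : IsNoetherian W (W ⧸ Ideal.span {algebraMap B W b}) := isNoetherian_of_tower B this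
  have hle : Ideal.span {algebraMap B W b} ≤ J := (Ideal.span_singleton_le_iff_mem J).mpr hbJ
  refine Submodule.fg_of_fg_map_of_fg_inf_ker (Ideal.span {algebraMap B W b}).mkQ
    (IsNoetherian.noetherian _) ?_
  rw [Submodule.ker_mkQ, inf_eq_right.mpr hle]
  exact Submodule.fg_span_singleton _

end KrullAkizuki

section ExistsDVR

variable {K : Type*} [Field K]

lemma isDVROf_of_notMem_of_krullDimLE_one {B : Type*} [CommRing B] [IsDomain B]
    [IsNoetherianRing B] [Ring.KrullDimLE 1 B] [Algebra B K] [IsFractionRing B K]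
    {V : ValuationSubring K} (hBV : (algebraMap B K).range ≤ V.toSubring) {c : K} (hc : c ∉ V) :
    IsDVROf V.toSubring := by
  let _ : Algebra B V :=
    ((algebraMap B K).codRestrict V.toSubring fun b => hBV ⟨b, rfl⟩).toAlgebra
  have : IsScalarTower B V K := IsScalarTower.of_algebraMap_eq fun _ => rfl
  have : IsNoetherianRing V := isNoetherianRing_of_krullDimLE_one B K
  have hVK : ¬ IsField V := by
    intro hfield
    obtain ⟨x, hx⟩ := (IsFractionRing.surjective_iff_isField (R := V) (K := K)).mpr hfield c
    exact hc (hx ▸ x.2)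
  have hval : ValuationRing V := inferInstance
  exact ⟨inferInstanceAs (IsDomain V), ((IsDiscreteValuationRing.TFAE V hVK).out 0 1).mpr hval,
    inferInstanceAs (IsFractionRing V K)⟩

lemma not_isUnit_of_inv_notMem {T : Subring K} {g : T} (hg : (g : K)⁻¹ ∉ T) : ¬ IsUnit g := by
  intro hunit
  obtain ⟨u, hu⟩ := hunit.exists_right_inv
  exact hg (eq_inv_of_mul_eq_one_right (congrArg Subtype.val hu) ▸ u.2)

lemma exists_localSubring_krullDimLE_one (T : Subring K) [IsNoetherianRing T]
    [IsFractionRing T K] {g : T} (hg : ¬ IsUnit g) :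
    ∃ (L : LocalSubring K) (hTL : T ≤ L.toSubring), IsNoetherianRing L.toSubring ∧
      IsFractionRing L.toSubring K ∧ Ring.KrullDimLE 1 L.toSubring ∧
      Subring.inclusion hTL g ∈ IsLocalRing.maximalIdeal L.toSubring := by
  have hspan : Ideal.span {g} ≠ ⊤ := mt Ideal.span_singleton_eq_top.mp hg
  obtain ⟨P, hP⟩ := Ideal.nonempty_minimalPrimes hspan
  have := hP.1.1
  have hgP : g ∈ P := hP.1.2 (Ideal.mem_span_singleton_self g)
  let L := LocalSubring.ofPrime T P
  have : IsLocalization.AtPrime L.toSubring P :=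
    inferInstanceAs (IsLocalization.AtPrime (LocalSubring.ofPrime T P).toSubring P)
  have : IsScalarTower T L.toSubring K :=
    inferInstanceAs (IsScalarTower T (LocalSubring.ofPrime T P).toSubring K)
  refine ⟨L, LocalSubring.le_ofPrime T P, IsLocalization.isNoetherianRing P.primeCompl _ ‹_›,
    IsFractionRing.isFractionRing_of_isDomain_of_isLocalization P.primeCompl L.toSubring K, ?_,
    (IsLocalization.AtPrime.to_map_mem_maximal_iff L.toSubring P g).mpr hgP⟩
  rw [Ring.krullDimLE_iff, IsLocalization.AtPrime.ringKrullDim_eq_height P L.toSubring]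
  exact_mod_cast Ideal.height_le_one_of_isPrincipal_of_mem_minimalPrimes _ P hP

theorem exists_isDVROf_notMem (T : Subring K) [IsNoetherianRing T] [IsFractionRing T K]
    {c : K} (hc : c⁻¹ ∈ T) (hcT : c ∉ T) :
    ∃ V : Subring K, IsDVROf V ∧ T ≤ V ∧ c ∉ V := by
  have hc0 : c ≠ 0 := fun h => hcT (h ▸ T.zero_mem)
  have hunit : ¬ IsUnit (⟨c⁻¹, hc⟩ : T) := not_isUnit_of_inv_notMem (by rwa [inv_inv])
  obtain ⟨L, hTL, _, _, _, hcL⟩ := exists_localSubring_krullDimLE_one T hunit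
  obtain ⟨V, hLV, hloc⟩ := L.exists_le_valuationSubring
  have hcV : c ∉ V := by
    intro hcV
    have hinv : IsUnit (⟨c⁻¹, hLV (hTL hc)⟩ : V) :=
      IsUnit.of_mul_eq_one ⟨c, hcV⟩ (Subtype.ext (inv_mul_cancel₀ hc0))
    exact (IsLocalRing.mem_maximalIdeal _).mp hcL (hloc.map_nonunit ⟨c⁻¹, hTL hc⟩ hinv)
  have hrange : (algebraMap L.toSubring K).range ≤ V.toSubring := by
    rintro _ ⟨x, rfl⟩
    exact hLV x.2
  exact ⟨V.toSubring, isDVROf_of_notMem_of_krullDimLE_one hrange hcV, hTL.trans hLV, hcV⟩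

theorem exists_isDVROf_of_prime {A : Type*} [CommRing A] [IsDomain A] [IsNoetherianRing A]
    [Algebra A K] [IsFractionRing A K] {f : A} (hf : Prime f) :
    ∃ V : Subring K, IsDVROf V ∧ (algebraMap A K).range ≤ V ∧
      ∀ x ∈ V, ∃ s ∉ Ideal.span {f}, ∃ a, algebraMap A K s * x = algebraMap A K a := by
  have hP : (Ideal.span {f}).IsPrime := (Ideal.span_singleton_prime hf.ne_zero).mpr hf
  set P := Ideal.span {f}
  have hS : P.primeCompl ≤ nonZeroDivisors A := P.primeCompl_le_nonZeroDivisors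
  let V := Localization.subalgebra.ofField K P.primeCompl hS
  have : IsLocalization.AtPrime V P := inferInstanceAs
    (IsLocalization P.primeCompl (Localization.subalgebra.ofField K P.primeCompl hS))
  have : IsLocalRing V := IsLocalization.AtPrime.isLocalRing V P
  have : IsNoetherianRing V := IsLocalization.isNoetherianRing P.primeCompl _ ‹_›
  have hmax : IsLocalRing.maximalIdeal V = Ideal.span {algebraMap A V f} := by
    rw [← IsLocalization.AtPrime.map_eq_maximalIdeal P V, Ideal.map_span, Set.image_singleton]
  have hfield : ¬ IsField V := by
    rw [IsLocalRing.isField_iff_maximalIdeal_eq, hmax, Ideal.span_singleton_eq_bot,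
      map_eq_zero_iff _ (FaithfulSMul.algebraMap_injective A V)]
    exact hf.ne_zero
  have hprincipal : (IsLocalRing.maximalIdeal V).IsPrincipal := ⟨_, hmax⟩
  refine ⟨V.toSubring, ⟨inferInstanceAs (IsDomain V),
    ((IsDiscreteValuationRing.TFAE V hfield).out 0 4).mpr hprincipal,
    inferInstanceAs (IsFractionRing V K)⟩, ?_, ?_⟩
  · rintro _ ⟨a, rfl⟩
    exact V.algebraMap_mem a
  · rintro _ ⟨a, s, hs, rfl⟩
    have hs0 : algebraMap A K s ≠ 0 := by
      rw [Ne, map_eq_zero_iff _ (IsFractionRing.injective A K)]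
      exact nonZeroDivisors.ne_zero (hS hs)
    exact ⟨s, hs, a, by field_simp⟩

end ExistsDVR

section Completion

variable {P R : Type*} [CommRing P] [CommRing R] [Algebra P R] {J : Ideal P}

lemma nonempty_algHom_adicCompletion_map :
    Nonempty (AdicCompletion J P →ₐ[P] AdicCompletion (J.map (algebraMap P R)) R) := by
  have hpow (n : ℕ) : J ^ n ≤ (J.map (algebraMap P R) ^ n).comap (Algebra.ofId P R) :=
    Ideal.map_le_iff_le_comap.mp (Ideal.map_pow (algebraMap P R) J n).le
  refine ⟨AdicCompletion.liftAlgHom _ (fun n =>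
    (Ideal.quotientMapₐ _ (Algebra.ofId P R) (hpow n)).comp (AdicCompletion.evalₐ J n)) ?_⟩
  intro m n hmn
  ext x
  induction x using AdicCompletion.induction_on with
  | h a =>
    simp only [AlgHom.comp_apply, AdicCompletion.evalₐ_mk]
    exact congrArg (Ideal.quotientMapₐ _ (Algebra.ofId P R) (hpow m))
      (AdicCompletion.Ideal.mk_eq_mk J hmn a)

lemma surjective_algHom_adicCompletion_map (hPR : Function.Surjective (algebraMap P R)) (hJ : J.FG)
    (F : AdicCompletion J P →ₐ[P] AdicCompletion (J.map (algebraMap P R)) R) :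
    Function.Surjective F := by
  let Jhat := J.map (algebraMap P (AdicCompletion J P))
  have hmap : Jhat.map F.toRingHom =
      (J.map (algebraMap P R)).map (algebraMap R (AdicCompletion (J.map (algebraMap P R)) R)) := by
    rw [Ideal.map_map, Ideal.map_map, AlgHom.toRingHom_eq_coe, F.comp_algebraMap,
      ← IsScalarTower.algebraMap_eq]
  have : IsAdicComplete Jhat (AdicCompletion J P) := AdicCompletion.isAdicComplete_self J hJ
  have : IsHausdorff (Jhat.map F.toRingHom) (AdicCompletion (J.map (algebraMap P R)) R) :=
    hmap ▸ (AdicCompletion.isAdicComplete_self _ (hJ.map _)).toIsHausdorff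
  refine surjective_of_mk_map_comp_surjective (I := Jhat) F.toRingHom fun y => ?_
  obtain ⟨y, rfl⟩ := Ideal.Quotient.mk_surjective y
  obtain ⟨r, hr⟩ := Ideal.Quotient.mk_surjective (AdicCompletion.evalOneₐ _ y)
  obtain ⟨p, rfl⟩ := hPR r
  refine ⟨algebraMap P _ p, Ideal.Quotient.eq.mpr ?_⟩
  rw [hmap, ← AdicCompletion.ker_evalOneₐ_eq_map _ (hJ.map _), RingHom.mem_ker, map_sub,
    sub_eq_zero]
  change AdicCompletion.evalOneₐ _ (F (algebraMap P _ p)) = AdicCompletion.evalOneₐ _ y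
  rw [F.commutes, ← hr, AdicCompletion.algebraMap_apply]
  rfl

instance isNoetherianRing_adicCompletion [IsNoetherianRing R] (I : Ideal R) :
    IsNoetherianRing (AdicCompletion I R) := by
  obtain ⟨n, x, rfl⟩ := Submodule.fg_iff_exists_fin_generating_family.mp
    (IsNoetherian.noetherian I)
  let _ : Algebra (MvPolynomial (Fin n) R) R := (MvPolynomial.aeval x).toRingHom.toAlgebra
  have hmap : (MvPolynomial.idealOfVars (Fin n) R).map (algebraMap _ R) =
      Ideal.span (Set.range x) := by
    rw [MvPolynomial.idealOfVars, Ideal.map_span, ← Set.range_comp]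
    congr 2
    ext i
    exact MvPolynomial.aeval_X x i
  rw [Ideal.submodule_span_eq, ← hmap]
  have : IsNoetherianRing (AdicCompletion (MvPolynomial.idealOfVars (Fin n) R) _) :=
    isNoetherianRing_of_ringEquiv _ (MvPowerSeries.toAdicCompletionAlgEquiv (Fin n) R).toRingEquiv
  obtain ⟨F⟩ := nonempty_algHom_adicCompletion_map (R := R)
    (J := MvPolynomial.idealOfVars (Fin n) R)
  exact isNoetherianRing_of_surjective _ _ F.toRingHom <|
    surjective_algHom_adicCompletion_map (fun r => ⟨MvPolynomial.C r, MvPolynomial.aeval_C x r⟩)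
      (MvPolynomial.idealOfVars_fg (Fin n) R) F

end Completion

section RegularLocal

open IsLocalRing

variable {R : Type*} [CommRing R]

lemma ringKrullDim_le_of_flat_of_isLocalHom [IsLocalRing R] [IsNoetherianRing R]
    (A : Type*) [CommRing A] [IsLocalRing A] [IsNoetherianRing A] [Algebra R A] [Module.Flat R A]
    [IsLocalHom (algebraMap R A)] : ringKrullDim R ≤ ringKrullDim A := by
  have : (maximalIdeal A).LiesOver (maximalIdeal R) := ⟨(maximalIdeal_comap (algebraMap R A)).symm⟩
  rw [← maximalIdeal_height_eq_ringKrullDim, ← maximalIdeal_height_eq_ringKrullDim,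
    Ideal.height_eq_height_add_of_liesOver_of_hasGoingDown (maximalIdeal R) (maximalIdeal A)]
  exact WithBot.coe_le_coe.mpr le_self_add

instance isRegularLocalRing_adicCompletion [IsRegularLocalRing R] :
    IsRegularLocalRing (AdicCompletion (maximalIdeal R) R) :=
  .of_spanFinrank_maximalIdeal_le _ <| by
    rw [AdicCompletion.spanFinrank_maximalIdeal_eq, IsRegularLocalRing.spanFinrank_maximalIdeal]
    exact ringKrullDim_le_of_flat_of_isLocalHom _

lemma ringKrullDim_adicCompletion [IsRegularLocalRing R] :
    ringKrullDim (AdicCompletion (maximalIdeal R) R) = ringKrullDim R := by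
  rw [← IsRegularLocalRing.spanFinrank_maximalIdeal, AdicCompletion.spanFinrank_maximalIdeal_eq,
    IsRegularLocalRing.spanFinrank_maximalIdeal]

lemma isDomain_of_lt_span_singleton [IsLocalRing R] [IsNoetherianRing R] {q : Ideal R}
    [hq : q.IsPrime] {f : R} [hf : (Ideal.span {f}).IsPrime] (hlt : q < Ideal.span {f}) :
    IsDomain R := by
  have hfq : f ∉ q := fun h => hlt.not_ge ((Ideal.span_singleton_le_iff_mem _).mpr h)
  obtain rfl : q = ⊥ := by
    refine Submodule.eq_bot_of_le_smul_of_le_jacobson_bot (Ideal.span {f}) q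
      (IsNoetherian.noetherian q) (fun a ha => ?_) ?_
    · obtain ⟨c, rfl⟩ := Ideal.mem_span_singleton'.mp (hlt.le ha)
      rw [mul_comm]
      exact Submodule.smul_mem_smul (Ideal.mem_span_singleton_self f)
        ((hq.mem_or_mem ha).resolve_right hfq)
    · exact (le_maximalIdeal hf.ne_top).trans (jacobson_eq_maximalIdeal _ bot_ne_top).ge
  exact IsDomain.of_bot_isPrime R

lemma isPrincipal_of_isPrincipalIdealRing_quotient {P : Ideal R} [hP : P.IsPrime] (hfg : P.FG)
    {x : R} (hx : x ∈ (⊥ : Ideal R).jacobson) (hxP : x ∉ P)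
    [IsPrincipalIdealRing (R ⧸ Ideal.span {x})] : P.IsPrincipal := by
  obtain ⟨fbar, hfbar⟩ := IsPrincipalIdealRing.principal (P.map (Ideal.Quotient.mk (.span {x})))
  obtain ⟨f, hfP, rfl⟩ := (Ideal.mem_map_iff_of_surjective _ Ideal.Quotient.mk_surjective).mp
    (hfbar ▸ Submodule.mem_span_singleton_self fbar)
  have hle : P ≤ Ideal.span {f} ⊔ Ideal.span {x} • P := fun a ha => by
    have hmem := Ideal.mem_map_of_mem (Ideal.Quotient.mk (.span {x})) ha
    rw [hfbar, Submodule.mem_span_singleton] at hmem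
    obtain ⟨bbar, hb⟩ := hmem
    obtain ⟨b, rfl⟩ := Ideal.Quotient.mk_surjective bbar
    rw [smul_eq_mul, ← map_mul, eq_comm, Ideal.Quotient.mk_eq_mk_iff_sub_mem] at hb
    obtain ⟨c, hc⟩ := Ideal.mem_span_singleton'.mp hb
    have hxc : c * x ∈ P := hc ▸ P.sub_mem ha (P.mul_mem_left b hfP)
    rw [← sub_add_cancel a (b * f), add_comm, ← hc, mul_comm c]
    exact Submodule.add_mem_sup (Ideal.mem_span_singleton'.mpr ⟨b, rfl⟩) <|
      Submodule.smul_mem_smul (Ideal.mem_span_singleton_self x)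
        ((hP.mem_or_mem hxc).resolve_right hxP)
  refine ⟨f, le_antisymm ?_ ((Ideal.span_singleton_le_iff_mem _).mpr hfP)⟩
  exact Submodule.le_of_le_smul_of_le_jacobson_bot hfg
    ((Ideal.span_singleton_le_iff_mem _).mpr hx) hle

section TwoGenerators

variable [IsLocalRing R] [IsNoetherianRing R]

lemma isDomain_of_isPrincipal_maximalIdeal (hm : (maximalIdeal R).IsPrincipal)
    (hdim : 0 < ringKrullDim R) : IsDomain R := by
  rw [← maximalIdeal_height_eq_ringKrullDim] at hdim
  have hheight : (maximalIdeal R).height ≠ 0 := (WithBot.coe_lt_coe.mp hdim).ne'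
  obtain ⟨q, hq, hqm⟩ := Ideal.exists_minimalPrimes_le (bot_le : ⊥ ≤ maximalIdeal R)
  have : q.IsPrime := hq.1.1
  replace hqm : q < maximalIdeal R :=
    hqm.lt_of_ne fun h => hheight (Ideal.height_eq_zero_iff.mpr (h ▸ hq))
  obtain ⟨f, hf⟩ := hm
  rw [Ideal.submodule_span_eq] at hf
  have : (Ideal.span {f}).IsPrime := hf ▸ inferInstance
  exact isDomain_of_lt_span_singleton (hf ▸ hqm)

lemma isDomain_and_isPrincipalIdealRing_quotient_span_singleton {x y : R}
    (hm : maximalIdeal R = Ideal.span {x, y}) (hdim : 1 < ringKrullDim R) :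
    IsDomain (R ⧸ Ideal.span {x}) ∧ IsPrincipalIdealRing (R ⧸ Ideal.span {x}) := by
  have hx : x ∈ maximalIdeal R := hm ▸ Ideal.subset_span (Set.mem_insert x {y})
  have : Nontrivial (R ⧸ Ideal.span {x}) := Ideal.Quotient.nontrivial_iff.mpr <|
    mt Ideal.span_singleton_eq_top.mp hx
  have : IsLocalRing (R ⧸ Ideal.span {x}) := .of_surjective' _ Ideal.Quotient.mk_surjective
  have hprincipal : (maximalIdeal (R ⧸ Ideal.span {x})).IsPrincipal := by
    refine ⟨Ideal.Quotient.mk _ y, ?_⟩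
    rw [← map_maximalIdeal_of_surjective _ Ideal.Quotient.mk_surjective, hm, Ideal.map_span,
      Set.image_pair, Ideal.Quotient.eq_zero_iff_mem.mpr (Ideal.mem_span_singleton_self x)]
    exact Submodule.span_insert_zero
  have : IsDomain (R ⧸ Ideal.span {x}) := by
    refine isDomain_of_isPrincipal_maximalIdeal hprincipal (lt_of_not_ge fun hle => ?_)
    have hdim_le := maximalIdeal_height_eq_ringKrullDim (R := R) ▸
      Ideal.height_le_ringKrullDim_quotient_add_one hx
    exact hdim.not_ge (hdim_le.trans (add_le_add_left hle 1))
  exact ⟨this, ((tfae_of_isNoetherianRing_of_isLocalRing_of_isDomain _).out 0 4).mpr hprincipal⟩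

lemma exists_maximalIdeal_eq_span_pair (hrank : (maximalIdeal R).spanFinrank = 2) :
    ∃ x y : R, maximalIdeal R = Ideal.span {x, y} := by
  have hcard := (IsNoetherian.noetherian (maximalIdeal R)).generators_ncard
  rw [hrank, Set.ncard_eq_two] at hcard
  obtain ⟨x, y, -, hxy⟩ := hcard
  exact ⟨x, y, hxy ▸ (Submodule.span_generators _).symm⟩

end TwoGenerators

variable [IsRegularLocalRing R] (hdim : ringKrullDim R = 2)
include hdim

lemma isPrincipal_of_ne_maximalIdeal (P : Ideal R) [hP : P.IsPrime] (hPm : P ≠ maximalIdeal R) :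
    P.IsPrincipal := by
  have hrank : (maximalIdeal R).spanFinrank = 2 := by
    exact_mod_cast (IsRegularLocalRing.spanFinrank_maximalIdeal (R := R)).trans hdim
  obtain ⟨x, y, hm⟩ := exists_maximalIdeal_eq_span_pair hrank
  obtain ⟨_, _⟩ := isDomain_and_isPrincipalIdealRing_quotient_span_singleton hm
    (hdim ▸ by decide)
  by_cases hxP : x ∈ P
  · have hker : RingHom.ker (Ideal.Quotient.mk (Ideal.span {x})) ≤ P := by
      rwa [Ideal.mk_ker, Ideal.span_singleton_le_iff_mem]
    have hprime := Ideal.map_isPrime_of_surjective Ideal.Quotient.mk_surjective hker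
    have hcomap : (P.map (Ideal.Quotient.mk (Ideal.span {x}))).comap (Ideal.Quotient.mk _) = P :=
      (Ideal.comap_map_of_surjective' _ Ideal.Quotient.mk_surjective P).trans
        (sup_eq_left.mpr hker)
    by_cases hbot : P.map (Ideal.Quotient.mk (Ideal.span {x})) = ⊥
    · refine ⟨x, ?_⟩
      rw [← hcomap, hbot, ← RingHom.ker_eq_comap_bot, Ideal.mk_ker, Ideal.submodule_span_eq]
    · have := hprime.isMaximal hbot
      have : P.IsMaximal := hcomap ▸
        Ideal.comap_isMaximal_of_surjective _ Ideal.Quotient.mk_surjective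
      exact absurd (eq_maximalIdeal this) hPm
  · refine isPrincipal_of_isPrincipalIdealRing_quotient (IsNoetherian.noetherian P) ?_ hxP
    rw [jacobson_eq_maximalIdeal _ bot_ne_top, hm]
    exact Ideal.subset_span (Set.mem_insert x {y})

lemma isDomain_of_ringKrullDim_eq_two : IsDomain R := by
  have hheight : (maximalIdeal R).height = 2 :=
    WithBot.coe_injective (maximalIdeal_height_eq_ringKrullDim.trans hdim)
  obtain ⟨q, hq, hqm, hqh⟩ : ∃ q : Ideal R, q.IsPrime ∧ q < maximalIdeal R ∧ 1 ≤ q.height := by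
    have : ¬ (maximalIdeal R).height ≤ (1 : ℕ) := by rw [hheight]; decide
    rw [Ideal.height_le_iff] at this
    push Not at this
    exact_mod_cast this
  obtain ⟨p, hp, hpq⟩ := Ideal.exists_minimalPrimes_le (bot_le : ⊥ ≤ q)
  have : p.IsPrime := hp.1.1
  replace hpq : p < q := hpq.lt_of_ne fun h =>
    zero_lt_one.not_ge (hqh.trans_eq (Ideal.height_eq_zero_iff.mpr (h ▸ hp)))
  obtain ⟨f, hf⟩ := isPrincipal_of_ne_maximalIdeal hdim q hqm.ne
  rw [Ideal.submodule_span_eq] at hf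
  have : (Ideal.span {f}).IsPrime := hf ▸ hq
  exact isDomain_of_lt_span_singleton (hf ▸ hpq)

end RegularLocal

section Generic

open nonZeroDivisors

variable {R : Type*} [CommRing R] {M : Type*} [AddCommGroup M] [Module R M]

instance isLocalizedModule_toGeneric : IsLocalizedModule R⁰ (toGeneric R M) :=
  (isLocalizedModule_iff_isBaseChange R⁰ (FractionRing R) _).mpr
    (TensorProduct.isBaseChange R M (FractionRing R))

lemma injective_toGeneric [IsDomain R] [Module.IsTorsionFree R M] :
    Function.Injective (toGeneric R M) := by
  refine (injective_iff_map_eq_zero _).mpr fun m hm => ?_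
  obtain ⟨s, hs⟩ := (IsLocalizedModule.eq_zero_iff R⁰ (toGeneric R M)).mp hm
  exact (smul_eq_zero.mp hs).resolve_left (nonZeroDivisors.ne_zero s.2)

lemma exists_nonZeroDivisors_smul_mem_range (x : Generic R M) :
    ∃ s ∈ R⁰, s • x ∈ LinearMap.range (toGeneric R M) := by
  obtain ⟨⟨m, s⟩, h⟩ := IsLocalizedModule.surj R⁰ (toGeneric R M) x
  exact ⟨s, s.2, m, h.symm⟩

lemma span_range_toGeneric :
    Submodule.span (FractionRing R) (Set.range (toGeneric R M)) = ⊤ := by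
  rw [← Set.image_univ]
  exact span_eq_top_of_isLocalizedModule (FractionRing R) R⁰ _ Submodule.span_univ

end Generic

section Functionals

variable {R : Type*} [CommRing R] {M : Type*} [AddCommGroup M] [Module R M]
  {V : Subring (FractionRing R)}

lemma liftBaseChange_mem_of_mem_extend {l : M →ₗ[R] FractionRing R} (hl : ∀ m, l m ∈ V)
    {x : Generic R M} (hx : x ∈ extend R M V) : l.liftBaseChange (FractionRing R) x ∈ V := by
  rw [extend] at hx
  induction hx using Submodule.span_induction with
  | mem x hx =>
    obtain ⟨m, rfl⟩ := hx
    simpa [toGeneric] using hl m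
  | zero => simp
  | add x y _ _ hx hy => simpa using add_mem hx hy
  | smul a x _ hx =>
    rw [LinearMap.map_smul_of_tower, Subring.smul_def, smul_eq_mul]
    exact mul_mem a.2 hx

lemma fg_extend [Module.Finite R M] (hV : (algebraMap R (FractionRing R)).range ≤ V) :
    (extend R M V).FG := by
  obtain ⟨S, hS⟩ := Module.Finite.fg_top (R := R) (M := M)
  let _ : Algebra R V :=
    ((algebraMap R (FractionRing R)).codRestrict V fun r => hV ⟨r, rfl⟩).toAlgebra
  have : IsScalarTower R V (FractionRing R) := .of_algebraMap_eq fun _ => rfl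
  have : IsScalarTower R V (Generic R M) := .to₁₂₄ R V (FractionRing R) (Generic R M)
  refine Submodule.fg_def.mpr ⟨toGeneric R M '' S, S.finite_toSet.image _, ?_⟩
  rw [← Submodule.span_span_of_tower R, Submodule.span_image, hS, Submodule.map_top, extend]
  rfl

lemma isLattice_extend [Module.Finite R M] (hV : (algebraMap R (FractionRing R)).range ≤ V) :
    (extend R M V).IsLattice (FractionRing R) where
  fg := fg_extend hV
  span_eq_top := by rw [extend, Submodule.span_span_of_tower, span_range_toGeneric]

lemma extendOfIsLattice_repr_coe {S K X ι : Type*} [CommRing S] [Field K] [Algebra S K]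
    [IsFractionRing S K] [AddCommGroup X] [Module S X] [Module K X] [IsScalarTower S K X]
    {N : Submodule S X} [N.IsLattice K] (b : Module.Basis ι S N) (n : N) (i : ι) :
    (b.extendOfIsLattice K).repr n i = algebraMap S K (b.repr n i) := by
  have h : ((b.extendOfIsLattice K).coord i).restrictScalars S ∘ₗ N.subtype =
      Algebra.linearMap S K ∘ₗ b.coord i := b.ext fun j => by
    classical
    have hj : ((b j : N) : X) = b.extendOfIsLattice K j := by simp
    simp only [LinearMap.comp_apply, Submodule.subtype_apply, hj, LinearMap.restrictScalars_apply,
      Module.Basis.coord_apply, Module.Basis.repr_self, Finsupp.single_apply,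
      Algebra.linearMap_apply, apply_ite (algebraMap S K), map_one, map_zero]
  exact LinearMap.congr_fun h n

lemma exists_functional_notMem [IsDomain R] [Module.Finite R M] (hDVR : IsDVROf V)
    (hV : (algebraMap R (FractionRing R)).range ≤ V) {x : Generic R M} (hx : x ∉ extend R M V) :
    ∃ l : M →ₗ[R] FractionRing R, (∀ m, l m ∈ V) ∧ l.liftBaseChange (FractionRing R) x ∉ V := by
  have := hDVR.isDomain
  have := hDVR.isDiscreteValuationRing
  have := hDVR.isFractionRing
  have := isLattice_extend (M := M) hV
  have : Module.IsTorsionFree V (FractionRing R) :=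
    Module.isTorsionFree_iff_algebraMap_injective.mpr (IsFractionRing.injective V (FractionRing R))
  have := Submodule.IsLattice.free (FractionRing R) (extend R M V)
  let b := Module.Free.chooseBasis V (extend R M V)
  let B := b.extendOfIsLattice (FractionRing R)
  have hB (m : M) (i) : B.repr (toGeneric R M m) i ∈ V := by
    rw [extendOfIsLattice_repr_coe b ⟨_, Submodule.subset_span ⟨m, rfl⟩⟩]
    exact Subtype.property _
  obtain ⟨i, hi⟩ : ∃ i, B.repr x i ∉ V := by
    by_contra! hcoord
    refine hx (B.sum_repr x ▸ sum_mem fun i _ => ?_)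
    rw [Module.Basis.extendOfIsLattice_apply]
    exact (extend R M V).smul_mem ⟨_, hcoord i⟩ (b i).2
  refine ⟨(LinearMap.liftBaseChangeEquiv (FractionRing R)).symm (B.coord i), fun m => ?_, ?_⟩
  · exact hB m i
  · rwa [LinearMap.liftBaseChange, LinearEquiv.apply_symm_apply]

end Functionals

section FaithfullyFlat

section GenericMap

variable (R : Type*) [CommRing R] [IsDomain R] (A : Type*) [CommRing A] [IsDomain A] [Algebra R A]
  [FaithfulSMul R A]

/-- The embedding of fraction fields induced by an injective ring homomorphism of domains. -/
noncomputable def fractionMap : FractionRing R →ₐ[R] FractionRing A :=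
  IsFractionRing.liftAlgHom (g := Algebra.ofId R (FractionRing A)) <|
    FaithfulSMul.algebraMap_injective R (FractionRing A)

variable (M : Type*) [AddCommGroup M] [Module R M]

/-- The canonical map from the generic fibre of `M` to that of its base change `A ⊗[R] M`. -/
noncomputable def genericMap : Generic R M →ₗ[R] Generic A (A ⊗[R] M) :=
  ((TensorProduct.AlgebraTensorModule.cancelBaseChange R A (FractionRing A) (FractionRing A)
    M).symm.toLinearMap.restrictScalars R) ∘ₗ (fractionMap R A).toLinearMap.rTensor M

@[simp]
lemma genericMap_tmul (k : FractionRing R) (m : M) :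
    genericMap R A M (k ⊗ₜ m) = fractionMap R A k ⊗ₜ[A] ((1 : A) ⊗ₜ[R] m) := by
  simp [genericMap]

lemma genericMap_toGeneric (m : M) :
    genericMap R A M (toGeneric R M m) = toGeneric A (A ⊗[R] M) (1 ⊗ₜ m) := by
  simp [toGeneric]

variable {R M}

lemma liftBaseChange_genericMap (l : M →ₗ[R] FractionRing R) (x : Generic R M) :
    (((fractionMap R A).toLinearMap ∘ₗ l).liftBaseChange A).liftBaseChange (FractionRing A)
      (genericMap R A M x) = fractionMap R A (l.liftBaseChange (FractionRing R) x) := by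
  induction x using TensorProduct.induction_on with
  | zero => simp only [map_zero]
  | add x y hx hy => simp only [map_add, hx, hy]
  | tmul k m => simp

end GenericMap

section Contraction

lemma mem_of_one_tmul_mem_baseChange {R : Type*} [CommRing R] (A : Type*) [CommRing A]
    [Algebra R A] [Module.FaithfullyFlat R A] {M : Type*} [AddCommGroup M] [Module R M]
    {N : Submodule R M} {m : M} (hm : (1 : A) ⊗ₜ[R] m ∈ N.baseChange A) : m ∈ N := by
  rwa [← Submodule.span_singleton_le_iff_mem, ← Submodule.baseChange_le_iff (A := A),
    Submodule.baseChange_span, Set.image_singleton, Submodule.span_singleton_le_iff_mem]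

variable {R : Type*} [CommRing R] [IsDomain R] {A : Type*} [CommRing A] [IsDomain A] [Algebra R A]

lemma injective_lift_fractionMap [FaithfulSMul R A] :
    Function.Injective (Algebra.TensorProduct.lift (Algebra.ofId A (FractionRing A))
      (fractionMap R A) fun _ _ => .all _ _) := by
  refine IsLocalization.injective_of_map_algebraMap_zero
    (M := Algebra.algebraMapSubmonoid A (nonZeroDivisors R)) _ _ fun a ha => ?_
  rw [AlgHom.toRingHom_eq_coe, RingHom.coe_coe, AlgHom.commutes,
    map_eq_zero_iff _ (IsFractionRing.injective A _)] at ha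
  rw [ha, map_zero]

lemma mem_adjoin_of_fractionMap_mem_adjoin [Module.FaithfullyFlat R A] {s : Set (FractionRing R)}
    {c : FractionRing R} (hc : fractionMap R A c ∈ Algebra.adjoin A (fractionMap R A '' s)) :
    c ∈ Algebra.adjoin R s := by
  let μ := Algebra.TensorProduct.lift (Algebra.ofId A (FractionRing A)) (fractionMap R A)
    fun _ _ => .all _ _
  have hμ (x : FractionRing R) : fractionMap R A x = μ (1 ⊗ₜ x) := by simp [μ]
  have hle : Algebra.adjoin A ((fun x => (1 : A) ⊗ₜ[R] x) '' s) ≤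
      (Algebra.adjoin R s).baseChange A := Algebra.adjoin_le <| by
    rintro _ ⟨x, hx, rfl⟩
    exact Subalgebra.tmul_mem_baseChange (Algebra.subset_adjoin hx) 1
  simp only [hμ] at hc
  rw [← Function.comp_def μ, Set.image_comp, ← AlgHom.map_adjoin] at hc
  obtain ⟨z, hz, hzc⟩ := hc
  obtain rfl := injective_lift_fractionMap hzc
  refine mem_of_one_tmul_mem_baseChange A (N := (Algebra.adjoin R s).toSubmodule) ?_
  obtain ⟨t, ht⟩ := hle hz
  exact ⟨t, ht⟩

lemma exists_isDVROf_fractionMap_notMem [IsNoetherianRing A] [Module.FaithfullyFlat R A]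
    {T : Subalgebra R (FractionRing R)} (hT : T.FG) {c : FractionRing R} (hcinv : c⁻¹ ∈ T)
    (hc : c ∉ T) : ∃ W : Subring (FractionRing A), IsDVROf W ∧
      (algebraMap A (FractionRing A)).range ≤ W ∧ (∀ x ∈ T, fractionMap R A x ∈ W) ∧
      fractionMap R A c ∉ W := by
  obtain ⟨s, rfl⟩ := hT
  let B := Algebra.adjoin A (fractionMap R A '' s)
  have hmem {x} (hx : x ∈ Algebra.adjoin R (s : Set (FractionRing R))) : fractionMap R A x ∈ B := by
    have hle : Algebra.adjoin R (s : Set (FractionRing R)) ≤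
        (B.restrictScalars R).comap (fractionMap R A) :=
      Algebra.adjoin_le fun y hy => Algebra.subset_adjoin ⟨y, hy, rfl⟩
    exact hle hx
  have : IsNoetherianRing B.toSubring := isNoetherianRing_of_fg <|
    Subalgebra.fg_def.mpr ⟨_, s.finite_toSet.image _, rfl⟩
  have : IsFractionRing B.toSubring (FractionRing A) := inferInstanceAs (IsFractionRing B _)
  obtain ⟨W, hW, hBW, hcW⟩ := exists_isDVROf_notMem B.toSubring (c := fractionMap R A c)
    (by simpa using hmem hcinv) (mt mem_adjoin_of_fractionMap_mem_adjoin hc)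
  refine ⟨W, hW, ?_, fun x hx => hBW (hmem hx), hcW⟩
  rintro _ ⟨a, rfl⟩
  exact hBW (B.algebraMap_mem a)

end Contraction

section Descent

lemma IsDVROf.inv_mem {K : Type*} [Field K] {V : Subring K} (hV : IsDVROf V) {c : K}
    (hc : c ∉ V) : c⁻¹ ∈ V := by
  have := hV.isDomain
  have := hV.isDiscreteValuationRing
  have := hV.isFractionRing
  obtain ⟨a, ha⟩ | ⟨a, ha⟩ := ValuationRing.isInteger_or_isInteger V c
  · exact absurd (ha ▸ a.2) hc
  · exact ha ▸ a.2

lemma exists_fg_subalgebra_le {R S : Type*} [CommRing R] [CommRing S] [Algebra R S]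
    {N : Submodule R S} (hN : N.FG) {B : Subalgebra R S} (hNB : N ≤ B.toSubmodule) :
    ∃ T ≤ B, T.FG ∧ N ≤ T.toSubmodule := by
  obtain ⟨s, rfl⟩ := hN
  exact ⟨Algebra.adjoin R s, Algebra.adjoin_le (Submodule.span_le.mp hNB),
    Subalgebra.fg_adjoin_finset s, Algebra.span_le_adjoin R _⟩

variable {R : Type*} [CommRing R] [IsDomain R] {A : Type*} [CommRing A] [IsDomain A]
  [IsNoetherianRing A] [Algebra R A] [Module.FaithfullyFlat R A] {M : Type*} [AddCommGroup M]
  [Module R M] [Module.Finite R M]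

theorem IsIntegralOver.of_genericMap {x : Generic R M} (hx : IsIntegralOver (genericMap R A M x)) :
    IsIntegralOver x := by
  intro V hV hRV
  by_contra hxV
  obtain ⟨l, hlV, hlx⟩ := exists_functional_notMem hV hRV hxV
  set c := l.liftBaseChange (FractionRing R) x
  let B : Subalgebra R (FractionRing R) := { V with algebraMap_mem' := fun r => hRV ⟨r, rfl⟩ }
  obtain ⟨T, hTB, hT, hlT⟩ := exists_fg_subalgebra_le (B := B)
    (N := LinearMap.range l ⊔ Submodule.span R {c⁻¹})
    ((Module.Finite.iff_fg.mp inferInstance).sup (Submodule.fg_span_singleton _))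
    (sup_le (LinearMap.range_le_iff_comap.mpr (top_le_iff.mp fun m _ => hlV m))
      ((Submodule.span_singleton_le_iff_mem _ _).mpr (hV.inv_mem hlx)))
  obtain ⟨W, hW, hAW, hTW, hcW⟩ := exists_isDVROf_fractionMap_notMem (A := A) hT
    (hlT (Submodule.mem_sup_right (Submodule.mem_span_singleton_self _))) fun h => hlx (hTB h)
  have hlW (z : A ⊗[R] M) : ((fractionMap R A).toLinearMap ∘ₗ l).liftBaseChange A z ∈ W := by
    induction z using TensorProduct.induction_on with
    | zero => simp
    | add y z hy hz => simpa using add_mem hy hz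
    | tmul a m =>
      rw [LinearMap.liftBaseChange_tmul, Algebra.smul_def]
      exact mul_mem (hAW ⟨a, rfl⟩) (hTW _ (hlT (Submodule.mem_sup_left ⟨m, rfl⟩)))
  exact hcW (liftBaseChange_genericMap A l x ▸
    liftBaseChange_mem_of_mem_extend hlW (hx W hW hAW))

end Descent

end FaithfullyFlat

section Congruence

instance isTorsionFree_tensorProduct {R : Type*} [CommRing R] [IsDomain R] {A : Type*} [CommRing A]
    [Algebra R A] [Module.Flat R A] {M : Type*} [AddCommGroup M] [Module R M]
    [Module.IsTorsionFree R M] : Module.IsTorsionFree A (A ⊗[R] M) := by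
  have : Module.Flat R (Generic R M) := Module.Flat.trans R (FractionRing R) (Generic R M)
  have hinj : Function.Injective ((toGeneric R M).baseChange A) :=
    Module.Flat.lTensor_preserves_injective_linearMap _ injective_toGeneric
  exact hinj.moduleIsTorsionFree _ fun a z => map_smul _ a z

section Torsion

variable {R : Type*} [CommRing R] {Q : Type*} [AddCommGroup Q] [Module R Q]

lemma mem_range_lTensor_torsionBySet {N : Type*} [AddCommGroup N] [Module R N] [Module.Flat R N]
    {I : Ideal R} (hI : I.FG) {x : N ⊗[R] Q} (hx : ∀ r ∈ I, r • x = 0) :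
    x ∈ LinearMap.range (LinearMap.lTensor N (Submodule.torsionBySet R Q I).subtype) := by
  classical
  obtain ⟨s, rfl⟩ := hI
  let g : Q →ₗ[R] s → Q := LinearMap.pi fun r => LinearMap.lsmul R Q r
  have hker : LinearMap.ker g = Submodule.torsionBySet R Q (Ideal.span (s : Set R)) := by
    rw [← Submodule.torsionBySet_eq_torsionBySet_span]
    ext q
    simp [g, funext_iff]
  have hcoord (z : N ⊗[R] Q) (r : s) :
      TensorProduct.piRight R R N (fun _ => Q) (LinearMap.lTensor N g z) r = (r : R) • z := by
    induction z using TensorProduct.induction_on with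
    | zero => simp
    | add y z hy hz => simp only [map_add, Pi.add_apply, hy, hz, smul_add]
    | tmul n q => simp [g]
  rw [← hker]
  refine (Module.Flat.lTensor_exact N (LinearMap.exact_subtype_ker_map g) x).mp ?_
  refine (TensorProduct.piRight R R N _).injective (funext fun r => ?_)
  rw [hcoord, map_zero, Pi.zero_apply, hx _ (Ideal.subset_span r.2)]

variable {A : Type*} [CommRing A] [Algebra R A] {I : Ideal R}

lemma tmul_eq_zero_of_mem_map (hQ : Module.IsTorsionBySet R Q I) {a : A}
    (ha : a ∈ I.map (algebraMap R A)) (q : Q) : a ⊗ₜ[R] q = 0 := by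
  rw [← Submodule.restrictScalars_mem R, ← Ideal.smul_top_eq_map] at ha
  refine Submodule.smul_induction_on ha (fun r hr b _ => ?_) fun b c hb hc => ?_
  · rw [TensorProduct.smul_tmul, @hQ q ⟨r, hr⟩, TensorProduct.tmul_zero]
  · rw [TensorProduct.add_tmul, hb, hc, add_zero]

lemma exists_one_tmul_eq_of_isTorsionBySet
    (hA : Function.Surjective (algebraMap R (A ⧸ I.map (algebraMap R A))))
    (hQ : Module.IsTorsionBySet R Q I) (x : A ⊗[R] Q) : ∃ q : Q, (1 : A) ⊗ₜ[R] q = x := by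
  induction x using TensorProduct.induction_on with
  | zero => exact ⟨0, TensorProduct.tmul_zero _ _⟩
  | add x y hx hy =>
    obtain ⟨p, rfl⟩ := hx
    obtain ⟨q, rfl⟩ := hy
    exact ⟨p + q, TensorProduct.tmul_add _ _ _⟩
  | tmul a q =>
    obtain ⟨r, hr⟩ := hA (Ideal.Quotient.mk _ a)
    have hsub := tmul_eq_zero_of_mem_map hQ (Ideal.Quotient.eq.mp hr) q
    rw [TensorProduct.sub_tmul, sub_eq_zero] at hsub
    exact ⟨r • q, by rw [← hsub, Algebra.algebraMap_eq_smul_one, TensorProduct.smul_tmul]⟩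

lemma exists_one_tmul_eq_of_smul_eq_zero [Module.Flat R A] (hI : I.FG)
    (hA : Function.Surjective (algebraMap R (A ⧸ I.map (algebraMap R A))))
    {x : A ⊗[R] Q} (hx : ∀ r ∈ I, r • x = 0) : ∃ q : Q, (1 : A) ⊗ₜ[R] q = x := by
  obtain ⟨y, rfl⟩ := mem_range_lTensor_torsionBySet hI hx
  obtain ⟨q, rfl⟩ := exists_one_tmul_eq_of_isTorsionBySet hA
    (Submodule.torsionBySet_isTorsionBySet _) y
  exact ⟨q, rfl⟩

end Torsion

variable {R : Type*} [CommRing R] {A : Type*} [CommRing A] [Algebra R A] [Module.Flat R A]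
  {M : Type*} [AddCommGroup M] [Module R M] {I : Ideal R}

lemma exists_eq_one_tmul_add_smul (hI : I.FG)
    (hA : Function.Surjective (algebraMap R (A ⧸ I.map (algebraMap R A)))) {d : R}
    {w : A ⊗[R] M} (hw : ∀ r ∈ I, ∃ z : A ⊗[R] M, r • w = d • z) :
    ∃ (m : M) (z : A ⊗[R] M), w = 1 ⊗ₜ m + d • z := by
  let π := (LinearMap.range (LinearMap.lsmul R M d)).mkQ
  have hexact : Function.Exact (d • ·) (LinearMap.lTensor A π) := by
    have := lTensor_exact A (LinearMap.exact_map_mkQ_range (LinearMap.lsmul R M d))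
      (Submodule.mkQ_surjective _)
    convert this using 1
    ext z
    exact LinearMap.lTensor_smul_action A M d ▸ rfl
  have hπw : ∀ r ∈ I, r • LinearMap.lTensor A π w = 0 := fun r hr => by
    obtain ⟨z, hz⟩ := hw r hr
    rw [← map_smul, hz]
    exact hexact.apply_apply_eq_zero z
  obtain ⟨q, hq⟩ := exists_one_tmul_eq_of_smul_eq_zero hI hA hπw
  obtain ⟨m, rfl⟩ := Submodule.mkQ_surjective _ q
  obtain ⟨z, hz⟩ := (hexact (w - 1 ⊗ₜ m)).mp <| by
    rw [map_sub, ← hq, LinearMap.lTensor_tmul, sub_self]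
  exact ⟨m, z, eq_add_of_sub_eq' hz.symm⟩

lemma exists_sub_genericMap_mem_range [IsDomain R] [IsDomain A]
    [FaithfulSMul R A] [Module.IsTorsionFree R M] (hI : I.FG) (hI₀ : I ≠ ⊥)
    (hA : Function.Surjective (algebraMap R (A ⧸ I.map (algebraMap R A))))
    {v : Generic A (A ⊗[R] M)}
    (hv : ∀ r ∈ I, r • v ∈ LinearMap.range (toGeneric A (A ⊗[R] M))) :
    ∃ x : Generic R M, v - genericMap R A M x ∈ LinearMap.range (toGeneric A (A ⊗[R] M)) := by
  obtain ⟨d, hdI, hd⟩ := Submodule.exists_mem_ne_zero_of_ne_bot hI₀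
  obtain ⟨w, hw⟩ := hv d hdI
  have hwd : ∀ r ∈ I, ∃ z : A ⊗[R] M, r • w = d • z := fun r hr => by
    obtain ⟨z, hz⟩ := hv r hr
    refine ⟨z, injective_toGeneric (R := A) ?_⟩
    rw [LinearMap.map_smul_of_tower, LinearMap.map_smul_of_tower, hw, hz, smul_comm]
  obtain ⟨m, z, rfl⟩ := exists_eq_one_tmul_add_smul hI hA hwd
  have hdK : algebraMap R (FractionRing R) d ≠ 0 :=
    (map_ne_zero_iff _ (IsFractionRing.injective R _)).mpr hd
  let x := (algebraMap R (FractionRing R) d)⁻¹ • toGeneric R M m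
  have hx : d • genericMap R A M x = toGeneric A (A ⊗[R] M) (1 ⊗ₜ m) := by
    rw [← map_smul, ← algebraMap_smul (FractionRing R) d, smul_inv_smul₀ hdK, genericMap_toGeneric]
  refine ⟨x, z, ?_⟩
  have hdz : d • toGeneric A (A ⊗[R] M) z = d • (v - genericMap R A M x) := by
    rw [smul_sub, hx, ← hw, map_add, LinearMap.map_smul_of_tower, add_sub_cancel_left]
  have : Module.IsTorsionFree R (Generic A (A ⊗[R] M)) := .trans_faithfulSMul R (FractionRing A) _
  exact smul_right_injective _ hd hdz

end Congruence

section MaximalIdealPower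

open IsLocalRing nonZeroDivisors

lemma exists_smul_mem_range_of_mem_extend {R : Type*} [CommRing R] {M : Type*} [AddCommGroup M]
    [Module R M] {S : Submonoid R} {V : Subring (FractionRing R)}
    (hV : ∀ c ∈ V, ∃ s ∈ S, ∃ a, algebraMap R (FractionRing R) s * c = algebraMap R _ a)
    {x : Generic R M} (hx : x ∈ extend R M V) :
    ∃ s ∈ S, s • x ∈ LinearMap.range (toGeneric R M) := by
  rw [extend] at hx
  induction hx using Submodule.span_induction with
  | mem x hx => exact ⟨1, S.one_mem, by rwa [one_smul]⟩
  | zero => exact ⟨1, S.one_mem, by rw [smul_zero]; exact zero_mem _⟩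
  | add x y _ _ hx hy =>
    obtain ⟨s, hs, hx⟩ := hx
    obtain ⟨t, ht, hy⟩ := hy
    refine ⟨s * t, mul_mem hs ht, ?_⟩
    rw [smul_add, mul_smul s t y, mul_comm s t, mul_smul t s x]
    exact add_mem (Submodule.smul_mem _ t hx) (Submodule.smul_mem _ s hy)
  | smul c x _ hx =>
    obtain ⟨s, hs, hx⟩ := hx
    obtain ⟨t, ht, a, hta⟩ := hV c c.2
    have hcomm : (t * s) • c • x = a • s • x := by
      change (t * s) • (c : FractionRing R) • x = a • s • x
      rw [mul_comm, mul_smul, ← algebraMap_smul (FractionRing R) t, smul_smul, hta,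
        algebraMap_smul, smul_comm]
    exact ⟨t * s, mul_mem ht hs, hcomm ▸ Submodule.smul_mem _ a hx⟩

variable {R : Type*} [CommRing R] [IsDomain R] [IsNoetherianRing R] {M : Type*} [AddCommGroup M]
  [Module R M] {x : Generic R M}

lemma IsIntegralOver.exists_smul_mem_range (hx : IsIntegralOver x) (P : Ideal R) [hP : P.IsPrime]
    (hprinc : P.IsPrincipal) : ∃ s ∉ P, s • x ∈ LinearMap.range (toGeneric R M) := by
  obtain ⟨f, rfl⟩ := hprinc
  obtain rfl | hf := eq_or_ne f 0
  · obtain ⟨s, hs, hsx⟩ := exists_nonZeroDivisors_smul_mem_range x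
    exact ⟨s, by simpa using hs, hsx⟩
  · obtain ⟨V, hV, hRV, hVP⟩ := exists_isDVROf_of_prime (K := FractionRing R)
      ((Ideal.span_singleton_prime hf).mp hP)
    exact exists_smul_mem_range_of_mem_extend (S := (Ideal.span {f}).primeCompl) hVP (hx V hV hRV)

lemma IsIntegralOver.exists_maximalIdeal_pow_smul_mem_range [IsLocalRing R]
    (hR : ∀ P : Ideal R, P.IsPrime → P ≠ maximalIdeal R → P.IsPrincipal) (hx : IsIntegralOver x) :
    ∃ k : ℕ, ∀ a ∈ maximalIdeal R ^ k, a • x ∈ LinearMap.range (toGeneric R M) := by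
  let J := (LinearMap.range (toGeneric R M)).colon {x}
  have hrad : maximalIdeal R ≤ J.radical := by
    rw [Ideal.radical_eq_sInf]
    refine le_sInf fun P ⟨hJP, hP⟩ => ?_
    by_contra hPm
    obtain ⟨s, hs, hsx⟩ := hx.exists_smul_mem_range P (hR P hP fun h => hPm h.ge)
    exact hs (hJP (Submodule.mem_colon_singleton.mpr hsx))
  obtain ⟨k, hk⟩ := Ideal.exists_pow_le_of_le_radical_of_fg hrad (IsNoetherian.noetherian _)
  exact ⟨k, fun a ha => Submodule.mem_colon_singleton.mp (hk ha)⟩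

end MaximalIdealPower

section BaseChange

open IsLocalRing

lemma surjective_algebraMap_adicCompletion_quotient {R : Type*} [CommRing R] {I : Ideal R}
    (hI : I.FG) (k : ℕ) : Function.Surjective (algebraMap R
      (AdicCompletion I R ⧸ (I ^ k).map (algebraMap R (AdicCompletion I R)))) := by
  intro b
  obtain ⟨a, rfl⟩ := Ideal.Quotient.mk_surjective b
  obtain ⟨r, hr⟩ := Submodule.mkQ_surjective _ (AdicCompletion.eval I R k a)
  refine ⟨r, Ideal.Quotient.eq.mpr ?_⟩
  rw [← Submodule.restrictScalars_mem R, ← Ideal.smul_top_eq_map,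
    AdicCompletion.pow_smul_top_eq_ker_eval hI, LinearMap.mem_ker, map_sub, ← hr, sub_eq_zero]
  rfl

theorem IsIntegrallyClosed.tensorProduct {R : Type*} [CommRing R] [IsDomain R] [IsNoetherianRing R]
    [IsLocalRing R] (hR : ¬ IsField R) {A : Type*} [CommRing A] [IsDomain A] [IsNoetherianRing A]
    [IsLocalRing A] [Algebra R A] [Module.Flat R A] [IsLocalHom (algebraMap R A)]
    (hRA : ∀ k : ℕ, Function.Surjective
      (algebraMap R (A ⧸ (maximalIdeal R ^ k).map (algebraMap R A))))
    (hA : ∀ P : Ideal A, P.IsPrime → P ≠ maximalIdeal A → P.IsPrincipal) {M : Type*}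
    [AddCommGroup M] [Module R M] [Module.Finite R M] [Module.IsTorsionFree R M]
    (hM : IsIntegrallyClosed R M) : IsIntegrallyClosed A (A ⊗[R] M) := by
  have : Module.FaithfullyFlat R A := .of_flat_of_isLocalHom
  refine Set.Subset.antisymm (fun v hv V _ _ => Submodule.subset_span hv) fun v hv => ?_
  obtain ⟨k, hk⟩ := IsIntegralOver.exists_maximalIdeal_pow_smul_mem_range hA hv
  have hkR : ∀ r ∈ maximalIdeal R ^ k, r • v ∈ LinearMap.range (toGeneric A (A ⊗[R] M)) :=
    fun r hr => by
      rw [← algebraMap_smul A]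
      refine hk _ (Ideal.pow_right_mono (map_maximalIdeal_le (algebraMap R A)) k ?_)
      rw [← Ideal.map_pow]
      exact Ideal.mem_map_of_mem _ hr
  obtain ⟨x, w, hw⟩ := exists_sub_genericMap_mem_range (IsNoetherian.noetherian _)
    (pow_ne_zero k (mt isField_iff_maximalIdeal_eq.mpr hR)) (hRA k) hkR
  have hx : IsIntegralOver x := .of_genericMap (A := A) fun V hV hAV => by
    rw [← sub_sub_cancel v (genericMap R A M x), ← hw]
    exact sub_mem (hv V hV hAV) (Submodule.subset_span ⟨w, rfl⟩)
  obtain ⟨m, rfl⟩ := hM.ge hx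
  exact ⟨w + 1 ⊗ₜ m, by rw [map_add, hw, ← genericMap_toGeneric, sub_add_cancel]⟩

end BaseChange

end ModuleClosure

theorem mainTheorem11 {R : Type*} [CommRing R] [IsRegularLocalRing R]
    (hdim : ringKrullDim R = 2)
    {M : Type*} [AddCommGroup M] [Module R M] [Module.Finite R M] [Module.IsTorsionFree R M]
    (hM : ModuleClosure.IsIntegrallyClosed R M) :
    Module.Finite (AdicCompletion (IsLocalRing.maximalIdeal R) R)
        (AdicCompletion (IsLocalRing.maximalIdeal R) R ⊗[R] M) ∧
      Module.IsTorsionFree (AdicCompletion (IsLocalRing.maximalIdeal R) R)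
        (AdicCompletion (IsLocalRing.maximalIdeal R) R ⊗[R] M) ∧
      ModuleClosure.IsIntegrallyClosed (AdicCompletion (IsLocalRing.maximalIdeal R) R)
        (AdicCompletion (IsLocalRing.maximalIdeal R) R ⊗[R] M) := by
  have := ModuleClosure.isDomain_of_ringKrullDim_eq_two hdim
  have hdim' := ModuleClosure.ringKrullDim_adicCompletion.trans hdim
  have := ModuleClosure.isDomain_of_ringKrullDim_eq_two hdim'
  refine ⟨inferInstance, inferInstance, ?_⟩
  refine .tensorProduct (fun hR => ?_) ?_ (fun P _ => ?_) hM
  · rw [ringKrullDim_eq_zero_of_isField hR] at hdim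
    norm_num at hdim
  · exact ModuleClosure.surjective_algebraMap_adicCompletion_quotient (IsNoetherian.noetherian _)
  · exact ModuleClosure.isPrincipal_of_ne_maximalIdeal hdim' P
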